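/- Let $G$ be a discrete group which is uncountable or non-amenable. Let $(u_i)_{i\in\mathbb N}$ be a sequence of normalized $2$-cocycles on $G$ with values in the circle group $\mathbb T$, that is, $u_i:G\times G\to\mathbb T$ with $u_i(x,y)u_i(xy,z)=u_i(y,z)u_i(x,yz)$ and $u_i(x,e)=u_i(e,x)=1$ for all $x,y,z\in G$. For each $i$ let $\lambda_{u_i}$ be the left $u_i$-regular projective unitary representation of $G$ on $\ell^2(G)$, $(\lambda_{u_i}(x)f)(y)=u_i(y^{-1},x)f(x^{-1}y)$, and let $\alpha_i$ be the action of $G$ on $B(\ell^2(G))$ given by $\alpha_{i,g}(T)=\lambda_{u_i}(g)\,T\,\lambda_{u_i}(g)^*$. Let $(\phi_i)_{i\in\mathbb N}$ be any sequence of unit vectors in $\ell^2(G)$, and let $\bigotimes_i^{\phi_i}\ell^2(G)$ be the infinite tensor product Hilbert space along $(\phi_i)$. On this space let $\odot_i B(\ell^2(G))$ be the $*$-algebra, and $\otimes_i(B(\ell^2(G)),\phi_i)$ the von Neumann algebra, generated by the operators $\otimes_i T_i$ with $T_i\in B(\ell^2(G))$ and $T_i=I$ for all but finitely many $i$. Let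 $\odot_i\alpha_i$ be the action of $G$ on $\odot_i B(\ell^2(G))$ by $*$-automorphisms determined by $$(\odot_i\alpha_i)_g\Big(\big(\otimes_{i\in J}T_i\big)\otimes\big(\otimes_{i\notin J}I\big)\Big)=\big(\otimes_{i\in J}\alpha_{i,g}(T_i)\big)\otimes\big(\otimes_{i\notin J}I\big)$$ for all $g\in G$ and all finite $J\subset\mathbb N$. Then $\odot_i\alpha_i$ does not extend to an action of $G$ by $*$-automorphisms on the von Neumann algebra $\otimes_i(B(\ell^2(G)),\phi_i)$. -/

import Mathlib

universe v

noncomputable section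

namespace InfTensor

section Space

variable {H : ℕ → Type v} [∀ i, NormedAddCommGroup (H i)]

/-- Elementary families along a sequence of unit vectors `φ`: families `ψ` with `ψ i ∈ H i`
and `ψ i = φ i` for all but finitely many `i`. -/
def Elem (φ : ∀ i, Metric.sphere (0 : H i) 1) : Type v :=
  {ψ : ∀ i, H i // {i | ψ i ≠ φ i}.Finite}

theorem exists_support {φ : ∀ i, Metric.sphere (0 : H i) 1} (s : Finset (Elem φ)) :
    ∃ E : Finset ℕ, ∀ ψ ∈ s, ∀ i ∉ E, ψ.1 i = φ i := by
  classical
  refine ⟨s.biUnion fun ψ => ψ.2.toFinset, fun ψ hψ i hi => ?_⟩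
  by_contra hne
  exact hi (Finset.mem_biUnion.2 ⟨ψ, hψ, by simpa using hne⟩)

variable [∀ i, InnerProductSpace ℂ (H i)]

/-- The scalar product `∏ i, ⟨ψ i, ξ i⟩` of two elementary families; only finitely many factors
differ from `1`. (Mathlib's inner products are conjugate-linear in the first variable.) -/
def kernel (φ : ∀ i, Metric.sphere (0 : H i) 1) (ψ ξ : Elem φ) : ℂ :=
  ∏ᶠ i, inner ℂ (ψ.1 i) (ξ.1 i)

variable {φ : ∀ i, Metric.sphere (0 : H i) 1}

theorem inner_unit (i : ℕ) : inner ℂ (φ i : H i) (φ i : H i) = 1 := by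
  have h : ‖(φ i : H i)‖ = 1 := by simp
  simp [inner_self_eq_norm_sq_to_K, h]

theorem kernel_eq_prod {ψ ξ : Elem φ} (E : Finset ℕ) (h : ∀ i ∉ E, ψ.1 i = φ i)
    (h' : ∀ i ∉ E, ξ.1 i = φ i) : kernel φ ψ ξ = ∏ i ∈ E, inner ℂ (ψ.1 i) (ξ.1 i) := by
  refine finprod_eq_prod_of_mulSupport_subset _ fun i hi => ?_
  by_contra hE
  have hE' : i ∉ E := by simpa using hE
  exact hi (by simp only [h i hE', h' i hE', inner_unit])

end Space

section Positivity

open scoped ComplexOrder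

variable {n : Type*}

theorem gram_posSemidef {E : Type*} [NormedAddCommGroup E] [InnerProductSpace ℂ E]
    (w : n → E) : (Matrix.gram ℂ w).PosSemidef := by
  refine ⟨Matrix.isHermitian_gram ℂ w, fun c => ?_⟩
  have h : (c.sum fun i xi => c.sum fun j xj => star xi * Matrix.gram ℂ w i j * xj)
      = inner ℂ (c.sum fun i xi => xi • w i) (c.sum fun i xi => xi • w i) := by
    simp only [Finsupp.sum, sum_inner, Finset.mul_sum, inner_sum, inner_smul_left,
      inner_smul_right, Matrix.gram_apply, RCLike.star_def]
    rw [Finset.sum_comm]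
    refine Finset.sum_congr rfl fun i _ => Finset.sum_congr rfl fun j _ => by ring
  rw [h, inner_self_eq_norm_sq_to_K]
  positivity

/-- Entrywise product of finitely many matrices. -/
def entryProd (A : ℕ → Matrix n n ℂ) (E : Finset ℕ) : Matrix n n ℂ :=
  Matrix.of fun k l => ∏ i ∈ E, A i k l

theorem entryProd_posSemidef (A : ℕ → Matrix n n ℂ) (hA : ∀ i, (A i).PosSemidef)
    (E : Finset ℕ) : (entryProd A E).PosSemidef := by
  classical
  induction E using Finset.induction_on with
  | empty =>
    have h : entryProd A ∅ = Matrix.gram ℂ (fun _ : n => (1 : ℂ)) := by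
      ext; simp [entryProd]
    rw [h]
    exact gram_posSemidef _
  | insert i E hi ih =>
    have h : entryProd A (insert i E) = Matrix.hadamard (A i) (entryProd A E) := by
      ext; simp [entryProd, Finset.prod_insert hi]
    rw [h]
    exact (hA i).hadamard ih

theorem entryProd_sub_posSemidef (A B : ℕ → Matrix n n ℂ) (c : ℕ → ℝ) (hc : ∀ i, 0 ≤ c i)
    (hA : ∀ i, (A i).PosSemidef) (hB : ∀ i, (B i).PosSemidef)
    (h : ∀ i, (c i • A i - B i).PosSemidef) (E : Finset ℕ) :
    ((∏ i ∈ E, c i) • entryProd A E - entryProd B E).PosSemidef := by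
  classical
  induction E using Finset.induction_on with
  | empty =>
    have h : (∏ i ∈ (∅ : Finset ℕ), c i) • entryProd A ∅ - entryProd B ∅ = 0 := by
      ext; simp [entryProd]
    rw [h]
    exact Matrix.PosSemidef.zero
  | insert i E hi ih =>
    have e : (∏ j ∈ insert i E, c j) • entryProd A (insert i E) - entryProd B (insert i E)
        = Matrix.hadamard (c i • A i - B i) ((∏ j ∈ E, c j) • entryProd A E)
          + Matrix.hadamard (B i) ((∏ j ∈ E, c j) • entryProd A E - entryProd B E) := by
      ext k l
      simp only [entryProd, Finset.prod_insert hi, Matrix.sub_apply, Matrix.add_apply,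
        Matrix.smul_apply, Matrix.hadamard_apply, Matrix.of_apply, Complex.real_smul]
      push_cast
      ring
    rw [e]
    exact ((h i).hadamard ((entryProd_posSemidef A hA E).smul
      (Finset.prod_nonneg fun j _ => hc j))).add ((hB i).hadamard ih)

end Positivity

section Space

variable {H : ℕ → Type v} [∀ i, NormedAddCommGroup (H i)] [∀ i, InnerProductSpace ℂ (H i)]

/-- Finite formal linear combinations of elementary families. -/
abbrev Pre (φ : ∀ i, Metric.sphere (0 : H i) 1) : Type v := Elem φ →₀ ℂ

variable {φ : ∀ i, Metric.sphere (0 : H i) 1}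

/-- The sesquilinear form on formal linear combinations that extends `kernel`. -/
def form (f g : Elem φ →₀ ℂ) : ℂ :=
  f.sum fun ψ a => g.sum fun ξ b => star a * kernel φ ψ ξ * b

open scoped ComplexOrder in
theorem form_self_nonneg (f : Elem φ →₀ ℂ) : 0 ≤ form f f := by
  obtain ⟨E, hE⟩ := exists_support f.support
  have h := (entryProd_posSemidef (fun i => Matrix.gram ℂ fun ψ : Elem φ => ψ.1 i)
    (fun i => gram_posSemidef _) E).2 f
  have e : form f f = f.sum fun ψ a => f.sum fun ξ b => star a *
      entryProd (fun i => Matrix.gram ℂ fun ψ : Elem φ => ψ.1 i) E ψ ξ * b := by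
    refine Finset.sum_congr rfl fun ψ hψ => Finset.sum_congr rfl fun ξ hξ => ?_
    simp only [kernel_eq_prod E (hE ψ hψ) (hE ξ hξ), entryProd, Matrix.of_apply,
      Matrix.gram_apply]
  rw [e]
  exact h

theorem kernel_conj (ψ ξ : Elem φ) : star (kernel φ ξ ψ) = kernel φ ψ ξ := by
  classical
  obtain ⟨E, hE⟩ := exists_support ({ψ, ξ} : Finset (Elem φ))
  have h1 := hE ψ (by simp)
  have h2 := hE ξ (by simp)
  rw [kernel_eq_prod E h1 h2, kernel_eq_prod E h2 h1]
  simp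

instance : PreInnerProductSpace.Core ℂ (Pre φ) where
  inner f g := form f g
  conj_inner_symm f g := by
    simp only [form, Finsupp.sum, map_sum]
    rw [Finset.sum_comm]
    refine Finset.sum_congr rfl fun ψ _ => Finset.sum_congr rfl fun ξ _ => ?_
    rw [← kernel_conj ψ ξ]
    simp
    ring
  re_inner_nonneg f := by
    have h := form_self_nonneg f
    exact (Complex.le_def.1 h).1
  add_left f g k := by
    refine Finsupp.sum_add_index' (fun _ => by simp) fun ψ a b => ?_
    simp only [Finsupp.sum, ← Finset.sum_add_distrib, star_add, add_mul]
  smul_left f g r := by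
    refine (Finsupp.sum_smul_index (fun _ => by simp)).trans ?_
    simp only [form, Finsupp.sum, Finset.mul_sum, star_mul', RCLike.star_def,
      mul_assoc]

instance : SeminormedAddCommGroup (Pre φ) :=
  InnerProductSpace.Core.toSeminormedAddCommGroup (𝕜 := ℂ)

instance : InnerProductSpace ℂ (Pre φ) := .ofCore _

variable (φ) in
/-- The infinite tensor product Hilbert space `⊗_i H i` along the unit vectors `φ i`: the Hilbert
space completion of the formal linear combinations of elementary families, for the scalar
product determined by `⟨⊗ ψ i, ⊗ ξ i⟩ = ∏ i, ⟨ψ i, ξ i⟩` (null vectors are divided out). -/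
abbrev TensorSpace : Type v := UniformSpace.Completion (Pre φ)

/-- The elementary decomposable vector `⊗ ψ i`. -/
def tensor (ψ : Elem φ) : TensorSpace φ :=
  ((Finsupp.single ψ 1 : Elem φ →₀ ℂ) : Pre φ)

theorem inner_pre (f g : Pre φ) : inner ℂ f g = form f g := rfl

theorem inner_tensor (ψ ξ : Elem φ) :
    inner ℂ (tensor ψ) (tensor ξ) = ∏ᶠ i, inner ℂ (ψ.1 i) (ξ.1 i) := by
  rw [tensor, tensor, UniformSpace.Completion.inner_coe, inner_pre]
  simp [form, kernel]

theorem single_eq_smul_tensor (ψ : Elem φ) (a : ℂ) :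
    ((Finsupp.single ψ a : Pre φ) : TensorSpace φ) = a • tensor ψ := by
  rw [tensor, ← UniformSpace.Completion.coe_smul]
  simp

theorem dense_span_tensor :
    (Submodule.span ℂ (Set.range (tensor (φ := φ)))).topologicalClosure = ⊤ := by
  refine (Submodule.eq_top_iff'.2 fun x => ?_)
  refine closure_mono ?_ (UniformSpace.Completion.denseRange_coe x)
  rintro _ ⟨f, rfl⟩
  induction f using Finsupp.induction_linear with
  | zero => exact Submodule.zero_mem _
  | add f g hf hg => 
    rw [UniformSpace.Completion.coe_add]
    exact Submodule.add_mem _ hf hg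
  | single ψ a =>
    rw [single_eq_smul_tensor]
    exact Submodule.smul_mem _ _ (Submodule.subset_span ⟨ψ, rfl⟩)

theorem ext_tensor {F : Type*} [NormedAddCommGroup F] [NormedSpace ℂ F]
    {X Y : TensorSpace φ →L[ℂ] F} (h : ∀ ψ, X (tensor ψ) = Y (tensor ψ)) : X = Y := by
  refine ContinuousLinearMap.ext_on (s := Set.range (tensor (φ := φ))) ?_ ?_
  · intro x
    have := dense_span_tensor (φ := φ)
    have hx : x ∈ (Submodule.span ℂ (Set.range (tensor (φ := φ)))).topologicalClosure := by
      rw [this]; trivial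
    exact hx
  · rintro _ ⟨ψ, rfl⟩
    exact h ψ

/-- The family `T i (ψ i)` for `i ∈ J`, `ψ i` for `i ∉ J`. -/
def applyOn (J : Finset ℕ) (T : ∀ i, H i →L[ℂ] H i) (ψ : Elem φ) : Elem φ :=
  ⟨fun i => if i ∈ J then T i (ψ.1 i) else ψ.1 i, by
    refine (J.finite_toSet.union ψ.2).subset fun i hi => ?_
    by_cases hJ : i ∈ J
    · exact Or.inl hJ
    · exact Or.inr (by simpa [hJ] using hi)⟩

theorem form_mapDomain (t : Elem φ → Elem φ) (f g : Elem φ →₀ ℂ) :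
    form (f.mapDomain t) (g.mapDomain t)
      = f.sum fun ψ a => g.sum fun ξ b => star a * kernel φ (t ψ) (t ξ) * b := by
  unfold form
  rw [Finsupp.sum_mapDomain_index]
  · refine Finset.sum_congr rfl fun ψ _ => ?_
    dsimp only
    rw [Finsupp.sum_mapDomain_index] <;> intros <;> ring
  · intro; simp
  · intros; simp only [Finsupp.sum, ← Finset.sum_add_distrib, star_add, add_mul]

open scoped ComplexOrder in
theorem form_applyOn_le (J : Finset ℕ) (T : ∀ i, H i →L[ℂ] H i) (f : Elem φ →₀ ℂ) :
    form (f.mapDomain (applyOn J T)) (f.mapDomain (applyOn J T))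
      ≤ ((∏ i ∈ J, ‖T i‖ ^ 2 : ℝ) : ℂ) * form f f := by
  classical
  obtain ⟨E₀, hE₀⟩ := exists_support f.support
  set E := E₀ ∪ J with hEdef
  have hE : ∀ ψ ∈ f.support, ∀ i ∉ E, ψ.1 i = φ i := fun ψ hψ i hi =>
    hE₀ ψ hψ i fun h => hi (Finset.mem_union_left _ h)
  have hE' : ∀ ψ ∈ f.support, ∀ i ∉ E, (applyOn J T ψ).1 i = φ i := fun ψ hψ i hi => by
    have hJ : i ∉ J := fun h => hi (Finset.mem_union_right _ h)
    simp only [applyOn, hJ, if_false, hE ψ hψ i hi]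
  let A : ℕ → Matrix (Elem φ) (Elem φ) ℂ := fun i => Matrix.gram ℂ fun ψ : Elem φ => ψ.1 i
  let B : ℕ → Matrix (Elem φ) (Elem φ) ℂ := fun i =>
    Matrix.gram ℂ fun ψ : Elem φ => (applyOn J T ψ).1 i
  let c : ℕ → ℝ := fun i => if i ∈ J then ‖T i‖ ^ 2 else 1
  have hAB : ∀ i, (c i • A i - B i).PosSemidef := by
    intro i
    by_cases hJ : i ∈ J
    · have h := Matrix.posSemidef_opNorm_smul_gram_sub_gram (𝕜 := ℂ)
        (fun ψ : Elem φ => ψ.1 i) (T i)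
      simpa only [A, B, c, hJ, if_true, applyOn, Function.comp_def] using h
    · have h0 : c i • A i - B i = 0 := by
        simp only [A, B, c, hJ, if_false, applyOn, one_smul, sub_self]
      rw [h0]
      exact Matrix.PosSemidef.zero
  have key := (entryProd_sub_posSemidef A B c
    (fun i => by simp only [c]; split_ifs <;> positivity)
    (fun i => gram_posSemidef _) (fun i => gram_posSemidef _) hAB E).2 f
  have hc : ∏ i ∈ E, c i = ∏ i ∈ J, ‖T i‖ ^ 2 := by
    simp only [c, Finset.prod_ite_mem, hEdef, Finset.union_inter_cancel_right]
  rw [form_mapDomain, ← sub_nonneg]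
  convert key using 1
  rw [hc]
  simp only [form, Finsupp.sum, Finset.mul_sum, ← Finset.sum_sub_distrib]
  refine Finset.sum_congr rfl fun ψ hψ => Finset.sum_congr rfl fun ξ hξ => ?_
  rw [kernel_eq_prod E (hE ψ hψ) (hE ξ hξ), kernel_eq_prod E (hE' ψ hψ) (hE' ξ hξ)]
  simp only [entryProd, A, B, Matrix.sub_apply, Matrix.smul_apply, Matrix.of_apply,
    Matrix.gram_apply, Complex.real_smul]
  ring

theorem norm_pre_sq (f : Pre φ) : ((‖f‖ ^ 2 : ℝ) : ℂ) = form f f := by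
  rw [← inner_pre, inner_self_eq_norm_sq_to_K]
  norm_cast

theorem norm_applyOn_le (J : Finset ℕ) (T : ∀ i, H i →L[ℂ] H i) (f : Pre φ) :
    ‖(f.mapDomain (applyOn J T) : Pre φ)‖ ≤ (∏ i ∈ J, ‖T i‖) * ‖f‖ := by
  have h := form_applyOn_le J T f
  rw [← norm_pre_sq, ← norm_pre_sq, ← Complex.ofReal_mul, Complex.real_le_real,
    Finset.prod_pow, ← mul_pow] at h
  exact (sq_le_sq₀ (norm_nonneg _)
    (mul_nonneg (Finset.prod_nonneg fun _ _ => norm_nonneg _) (norm_nonneg _))).1 h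

variable (φ) in
/-- The operator `(⊗_{i ∈ J} T i) ⊗ (⊗_{i ∉ J} I)` on the infinite tensor product space. -/
def tensorOp (J : Finset ℕ) (T : ∀ i, H i →L[ℂ] H i) : TensorSpace φ →L[ℂ] TensorSpace φ :=
  (LinearMap.mkContinuous (Finsupp.lmapDomain ℂ ℂ (applyOn (φ := φ) J T)) (∏ i ∈ J, ‖T i‖)
    (norm_applyOn_le J T)).completion

theorem tensorOp_tensor (J : Finset ℕ) (T : ∀ i, H i →L[ℂ] H i) (ψ : Elem φ) :
    tensorOp φ J T (tensor ψ) = tensor (applyOn J T ψ) := by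
  rw [tensorOp, tensor, ContinuousLinearMap.completion_apply_coe]
  exact congrArg _ Finsupp.mapDomain_single

end Space

section Algebra

variable {H : ℕ → Type v} [∀ i, NormedAddCommGroup (H i)] [∀ i, InnerProductSpace ℂ (H i)]
  {φ : ∀ i, Metric.sphere (0 : H i) 1}

theorem tensorOp_mul (J : Finset ℕ) (S T : ∀ i, H i →L[ℂ] H i) :
    tensorOp φ J S * tensorOp φ J T = tensorOp φ J (fun i => S i * T i) := by
  refine ext_tensor fun ψ => ?_
  rw [mul_apply_eq_comp, tensorOp_tensor, tensorOp_tensor, tensorOp_tensor]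
  congr 1
  refine Subtype.ext (funext fun i => ?_)
  by_cases h : i ∈ J <;> simp [applyOn, h]

theorem tensorOp_one (J : Finset ℕ) : tensorOp φ J (fun _ => 1) = 1 := by
  refine ext_tensor fun ψ => ?_
  rw [tensorOp_tensor, one_apply_eq_self]
  congr 1
  refine Subtype.ext (funext fun i => ?_)
  simp [applyOn]

theorem tensorOp_of_subset {J K : Finset ℕ} (h : J ⊆ K) (T : ∀ i, H i →L[ℂ] H i) :
    tensorOp φ J T = tensorOp φ K (fun i => if i ∈ J then T i else 1) := by
  refine ext_tensor fun ψ => ?_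
  rw [tensorOp_tensor, tensorOp_tensor]
  congr 1
  refine Subtype.ext (funext fun i => ?_)
  by_cases hJ : i ∈ J
  · simp [applyOn, hJ, h hJ]
  · simp [applyOn, hJ]

variable (φ) in
/-- The `*`-algebra `⊙_i B(H i)` acting on the infinite tensor product space: it is generated
by the operators `⊗ T i` with `T i = I` for all but finitely many `i`. -/
def algTensor : StarSubalgebra ℂ (TensorSpace φ →L[ℂ] TensorSpace φ) :=
  StarAlgebra.adjoin ℂ {X | ∃ J T, X = tensorOp φ J T}

/-- The von Neumann algebra generated by a set of bounded operators on a Hilbert space: the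
double commutant of the set and of its adjoints. -/
def vonNeumannGenerated {K : Type*} [NormedAddCommGroup K] [InnerProductSpace ℂ K]
    [CompleteSpace K] (S : Set (K →L[ℂ] K)) : VonNeumannAlgebra K where
  toStarSubalgebra :=
    StarSubalgebra.centralizer ℂ (StarSubalgebra.centralizer ℂ S : Set (K →L[ℂ] K))
  centralizer_centralizer' := by
    change Set.centralizer (Set.centralizer (StarSubalgebra.centralizer ℂ
      (StarSubalgebra.centralizer ℂ S : Set (K →L[ℂ] K)) : Set (K →L[ℂ] K)))
      = (StarSubalgebra.centralizer ℂ
        (StarSubalgebra.centralizer ℂ S : Set (K →L[ℂ] K)) : Set (K →L[ℂ] K))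
    rw [StarSubalgebra.coe_centralizer_centralizer, Set.centralizer_centralizer_centralizer]

variable (φ) in
/-- The von Neumann algebra `⊗_i (B(H i), φ i)` on the infinite tensor product space, generated
by the operators `⊗ T i` with `T i = I` for all but finitely many `i`. -/
def vnTensor : VonNeumannAlgebra (TensorSpace φ) :=
  vonNeumannGenerated {X | ∃ J T, X = tensorOp φ J T}

theorem algTensor_le_vnTensor : algTensor φ ≤ (vnTensor φ).toStarSubalgebra :=
  StarAlgebra.adjoin_le_centralizer_centralizer ℂ _

theorem tensorOp_mem (J : Finset ℕ) (T : ∀ i, H i →L[ℂ] H i) :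
    tensorOp φ J T ∈ algTensor φ :=
  StarAlgebra.subset_adjoin ℂ _ ⟨J, T, rfl⟩

variable [∀ i, CompleteSpace (H i)]

theorem star_tensorOp (J : Finset ℕ) (T : ∀ i, H i →L[ℂ] H i) :
    star (tensorOp φ J T) = tensorOp φ J (fun i => star (T i)) := by
  refine ext_tensor fun ψ => ?_
  have key : ∀ ξ : Elem φ, innerSL ℂ (star (tensorOp φ J T) (tensor ψ)) (tensor ξ)
      = innerSL ℂ (tensorOp φ J (fun i => star (T i)) (tensor ψ)) (tensor ξ) := by
    intro ξ
    rw [innerSL_apply_apply, innerSL_apply_apply, ContinuousLinearMap.star_eq_adjoint,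
      ContinuousLinearMap.adjoint_inner_left, tensorOp_tensor, tensorOp_tensor, inner_tensor,
      inner_tensor]
    refine finprod_congr fun i => ?_
    by_cases h : i ∈ J
    · simp [applyOn, h, ContinuousLinearMap.star_eq_adjoint,
        ContinuousLinearMap.adjoint_inner_left]
    · simp [applyOn, h]
  refine ext_inner_right ℂ fun z => ?_
  exact congrArg (fun X : TensorSpace φ →L[ℂ] ℂ => X z) (ext_tensor key)

variable (φ) in
/-- The unitary `(⊗_{i ∈ J} U i) ⊗ (⊗_{i ∉ J} I)`. -/
def tensorUnitary (U : ∀ i, unitary (H i →L[ℂ] H i)) (J : Finset ℕ) :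
    unitary (TensorSpace φ →L[ℂ] TensorSpace φ) :=
  ⟨tensorOp φ J fun i => U i, by
    rw [Unitary.mem_iff, star_tensorOp, tensorOp_mul, tensorOp_mul]
    refine ⟨?_, ?_⟩
    · refine Eq.trans (congrArg _ (funext fun i => ?_)) (tensorOp_one J)
      exact Unitary.coe_star_mul_self (U i)
    · refine Eq.trans (congrArg _ (funext fun i => ?_)) (tensorOp_one J)
      exact Unitary.coe_mul_star_self (U i)⟩

section Conj

variable {A : Type*} [Ring A] [StarRing A]

theorem conj_add (V : unitary A) (x y : A) :
    V * (x + y) * star (V : A) = V * x * star (V : A) + V * y * star (V : A) := by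
  rw [mul_add, add_mul]

theorem conj_mul (V : unitary A) (x y : A) :
    V * (x * y) * star (V : A) = (V * x * star (V : A)) * (V * y * star (V : A)) := by
  have h := Unitary.coe_star_mul_self V
  rw [mul_assoc (V * x : A), ← mul_assoc (star (V : A)), ← mul_assoc (star (V : A)), h]
  simp only [one_mul, mul_assoc]

theorem conj_star (V : unitary A) (x : A) :
    V * star x * star (V : A) = star (V * x * star (V : A)) := by
  simp only [star_mul, star_star, mul_assoc]

theorem conj_smul [Algebra ℂ A] (V : unitary A) (r : ℂ) (x : A) :
    V * (r • x) * star (V : A) = r • (V * x * star (V : A)) := by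
  rw [mul_smul_comm, smul_mul_assoc]

theorem conj_algebraMap [Algebra ℂ A] (V : unitary A) (r : ℂ) :
    V * (algebraMap ℂ A r) * star (V : A) = algebraMap ℂ A r := by
  rw [← Algebra.commutes, mul_assoc, Unitary.mul_star_self_of_mem V.2, mul_one]

end Conj

variable (φ) in
/-- Conjugation by `(⊗_{i ∈ J} U i) ⊗ (⊗_{i ∉ J} I)`. -/
def localAd (U : ∀ i, unitary (H i →L[ℂ] H i)) (J : Finset ℕ)
    (X : TensorSpace φ →L[ℂ] TensorSpace φ) : TensorSpace φ →L[ℂ] TensorSpace φ :=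
  tensorUnitary φ U J * X * star (tensorUnitary φ U J : TensorSpace φ →L[ℂ] TensorSpace φ)

theorem localAd_tensorOp (U : ∀ i, unitary (H i →L[ℂ] H i)) {J K : Finset ℕ} (h : J ⊆ K)
    (T : ∀ i, H i →L[ℂ] H i) :
    localAd φ U K (tensorOp φ J T)
      = tensorOp φ J fun i => Unitary.conjStarAlgAut ℂ _ (U i) (T i) := by
  rw [tensorOp_of_subset h, tensorOp_of_subset h, localAd, tensorUnitary, star_tensorOp,
    tensorOp_mul, tensorOp_mul]
  congr 1
  funext i
  by_cases hJ : i ∈ J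
  · simp only [hJ, if_true, Unitary.conjStarAlgAut_apply]
  · simp only [hJ, if_false, mul_one]
    exact Unitary.coe_mul_star_self (U i)

theorem exists_localAd_eq (U : ∀ i, unitary (H i →L[ℂ] H i)) (x : algTensor φ) :
    ∃ y : algTensor φ, ∀ᶠ J in Filter.atTop,
      localAd φ U J (x : TensorSpace φ →L[ℂ] TensorSpace φ) = y := by
  induction x using StarAlgebra.adjoin_induction_subtype with
  | mem x hx =>
    obtain ⟨K, T, rfl⟩ := hx
    refine ⟨⟨_, tensorOp_mem K fun i => Unitary.conjStarAlgAut ℂ _ (U i) (T i)⟩, ?_⟩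
    filter_upwards [Filter.eventually_ge_atTop K] with J hJ
    exact localAd_tensorOp U hJ T
  | algebraMap r =>
    exact ⟨algebraMap ℂ _ r, Filter.Eventually.of_forall fun J => conj_algebraMap _ r⟩
  | add x y hx hy =>
    obtain ⟨x', hx'⟩ := hx
    obtain ⟨y', hy'⟩ := hy
    refine ⟨x' + y', ?_⟩
    filter_upwards [hx', hy'] with J h1 h2
    exact (conj_add _ _ _).trans (congrArg₂ (· + ·) h1 h2)
  | mul x y hx hy =>
    obtain ⟨x', hx'⟩ := hx
    obtain ⟨y', hy'⟩ := hy
    refine ⟨x' * y', ?_⟩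
    filter_upwards [hx', hy'] with J h1 h2
    exact (conj_mul _ _ _).trans (congrArg₂ (· * ·) h1 h2)
  | star x hx =>
    obtain ⟨x', hx'⟩ := hx
    refine ⟨star x', ?_⟩
    filter_upwards [hx'] with J h1
    exact (conj_star _ _).trans (congrArg star h1)

/-- The underlying map of `algAd`: the eventual value of `localAd φ U J x` as `J` grows. -/
def algAdFun (U : ∀ i, unitary (H i →L[ℂ] H i)) (x : algTensor φ) : algTensor φ :=
  (exists_localAd_eq U x).choose

theorem algAdFun_spec (U : ∀ i, unitary (H i →L[ℂ] H i)) (x : algTensor φ) :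
    ∀ᶠ J in Filter.atTop, localAd φ U J (x : TensorSpace φ →L[ℂ] TensorSpace φ) = algAdFun U x :=
  (exists_localAd_eq U x).choose_spec

theorem eq_of_eventually {x : algTensor φ} {U : ∀ i, unitary (H i →L[ℂ] H i)} {y : algTensor φ}
    (h : ∀ᶠ J in Filter.atTop, localAd φ U J (x : TensorSpace φ →L[ℂ] TensorSpace φ) = y) :
    algAdFun U x = y := by
  obtain ⟨J, h1, h2⟩ := ((algAdFun_spec U x).and h).exists
  exact Subtype.ext (h1.symm.trans h2)

theorem localAd_mul (U V : ∀ i, unitary (H i →L[ℂ] H i)) (J : Finset ℕ)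
    (X : TensorSpace φ →L[ℂ] TensorSpace φ) :
    localAd φ (fun i => U i * V i) J X = localAd φ U J (localAd φ V J X) := by
  have h : (tensorUnitary φ (fun i => U i * V i) J : TensorSpace φ →L[ℂ] TensorSpace φ)
      = tensorUnitary φ U J * tensorUnitary φ V J := (tensorOp_mul J _ _).symm
  rw [localAd, localAd, localAd, h, star_mul]
  simp only [mul_assoc]

theorem localAd_one (J : Finset ℕ) (X : TensorSpace φ →L[ℂ] TensorSpace φ) :
    localAd φ (fun i => (1 : unitary (H i →L[ℂ] H i))) J X = X := by
  have h : (tensorUnitary φ (fun i => (1 : unitary (H i →L[ℂ] H i))) J :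
      TensorSpace φ →L[ℂ] TensorSpace φ) = 1 := tensorOp_one J
  rw [localAd, h, star_one, one_mul, mul_one]

theorem algAdFun_mul (U V : ∀ i, unitary (H i →L[ℂ] H i)) (x : algTensor φ) :
    algAdFun (fun i => U i * V i) x = algAdFun U (algAdFun V x) := by
  refine eq_of_eventually ?_
  filter_upwards [algAdFun_spec V x, algAdFun_spec U (algAdFun V x)] with J h1 h2
  rw [localAd_mul, h1, h2]

theorem algAdFun_one (x : algTensor φ) :
    algAdFun (fun i => (1 : unitary (H i →L[ℂ] H i))) x = x := by
  refine eq_of_eventually (Filter.Eventually.of_forall fun J => ?_)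
  rw [localAd_one]

variable (φ) in
/-- The automorphism `⊙_i Ad(U i)` of the `*`-algebra `⊙_i B(H i)`. It is characterized by
`algAd_tensorOp` below. -/
def algAd (U : ∀ i, unitary (H i →L[ℂ] H i)) : algTensor φ ≃⋆ₐ[ℂ] algTensor φ where
  toFun := algAdFun U
  invFun := algAdFun fun i => (U i)⁻¹
  left_inv x := by rw [← algAdFun_mul]; simp [algAdFun_one]
  right_inv x := by rw [← algAdFun_mul]; simp [algAdFun_one]
  map_mul' x y := eq_of_eventually (by
    filter_upwards [algAdFun_spec U x, algAdFun_spec U y] with J h1 h2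
    exact (conj_mul _ _ _).trans (congrArg₂ (· * ·) h1 h2))
  map_add' x y := eq_of_eventually (by
    filter_upwards [algAdFun_spec U x, algAdFun_spec U y] with J h1 h2
    exact (conj_add _ _ _).trans (congrArg₂ (· + ·) h1 h2))
  map_star' x := eq_of_eventually (by
    filter_upwards [algAdFun_spec U x] with J h1
    exact (conj_star _ _).trans (congrArg star h1))
  map_smul' r x := eq_of_eventually (by
    filter_upwards [algAdFun_spec U x] with J h1
    exact (conj_smul _ r _).trans (congrArg (r • ·) h1))

theorem algAd_tensorOp (U : ∀ i, unitary (H i →L[ℂ] H i)) (J : Finset ℕ)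
    (T : ∀ i, H i →L[ℂ] H i) :
    algAd φ U ⟨_, tensorOp_mem J T⟩
      = ⟨_, tensorOp_mem J fun i => Unitary.conjStarAlgAut ℂ _ (U i) (T i)⟩ := by
  refine eq_of_eventually ?_
  filter_upwards [Filter.eventually_ge_atTop J] with K hK
  exact localAd_tensorOp U hK T

end Algebra

/-- A normalized 2-cocycle on `G` with values in the circle group. -/
structure TwoCocycle (G : Type*) [Group G] where
  /-- The underlying function of two variables. -/
  toFun : G → G → Circle
  cocycle : ∀ x y z, toFun x y * toFun (x * y) z = toFun y z * toFun x (y * z)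
  one_right : ∀ x, toFun x 1 = 1
  one_left : ∀ x, toFun 1 x = 1

/-- A projective unitary representation of `G` on `K` associated with the 2-cocycle `u`:
`U x * U y = u x y • U (x * y)`. -/
structure ProjUnitaryRep {G : Type*} [Group G] (u : TwoCocycle G) (K : Type*)
    [NormedAddCommGroup K] [InnerProductSpace ℂ K] [CompleteSpace K] where
  /-- The underlying unitary-valued map. -/
  toFun : G → unitary (K →L[ℂ] K)
  mul_eq : ∀ x y, (toFun x : K →L[ℂ] K) * (toFun y : K →L[ℂ] K)
    = (u.toFun x y : ℂ) • (toFun (x * y) : K →L[ℂ] K)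

section Actions

variable {G : Type*} [Group G]

/-- The action `Ad U` of `G` on `B(K)`, `(Ad U) g T = U g * T * star (U g)`. -/
def ProjUnitaryRep.ad {u : TwoCocycle G} {K : Type*} [NormedAddCommGroup K]
    [InnerProductSpace ℂ K] [CompleteSpace K] (U : ProjUnitaryRep u K) :
    G →* ((K →L[ℂ] K) ≃⋆ₐ[ℂ] (K →L[ℂ] K)) :=
  MonoidHom.mk' (fun g => Unitary.conjStarAlgAut ℂ _ (U.toFun g)) fun x y => by
    rw [← map_mul]
    refine StarAlgEquiv.ext fun T => ?_
    rw [Unitary.conjStarAlgAut_apply, Unitary.conjStarAlgAut_apply]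
    have h : ((U.toFun x * U.toFun y : unitary (K →L[ℂ] K)) : K →L[ℂ] K)
        = (u.toFun x y : ℂ) • (U.toFun (x * y) : K →L[ℂ] K) := U.mul_eq x y
    have hc : (u.toFun x y : ℂ) * star (u.toFun x y : ℂ) = 1 := by
      rw [RCLike.star_def, Complex.mul_conj, Circle.normSq_coe, Complex.ofReal_one]
    rw [h, star_smul, smul_mul_assoc, smul_mul_assoc, mul_smul_comm, smul_smul, hc, one_smul]

theorem ProjUnitaryRep.ad_apply {u : TwoCocycle G} {K : Type*} [NormedAddCommGroup K]
    [InnerProductSpace ℂ K] [CompleteSpace K] (U : ProjUnitaryRep u K) (g : G) (T : K →L[ℂ] K) :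
    U.ad g T = (U.toFun g : K →L[ℂ] K) * T * star (U.toFun g : K →L[ℂ] K) := rfl

variable {H : ℕ → Type v} [∀ i, NormedAddCommGroup (H i)] [∀ i, InnerProductSpace ℂ (H i)]
  [∀ i, CompleteSpace (H i)]

theorem algAd_congr (φ : ∀ i, Metric.sphere (0 : H i) 1) {U V : ∀ i, unitary (H i →L[ℂ] H i)}
    (h : ∀ i, Unitary.conjStarAlgAut ℂ _ (U i) = Unitary.conjStarAlgAut ℂ (H i →L[ℂ] H i) (V i)) :
    algAd φ U = algAd φ V := by
  refine StarAlgEquiv.ext fun x => ?_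
  induction x using StarAlgebra.adjoin_induction_subtype with
  | mem x hx =>
    obtain ⟨K, T, rfl⟩ := hx
    refine (algAd_tensorOp U K T).trans (Eq.trans ?_ (algAd_tensorOp V K T).symm)
    simp only [h]
  | algebraMap r =>
    have h1 : ∀ W : ∀ i, unitary (H i →L[ℂ] H i),
        algAd φ W (algebraMap ℂ (algTensor φ) r) = algebraMap ℂ (algTensor φ) r := fun W =>
      eq_of_eventually (Filter.Eventually.of_forall fun J => conj_algebraMap _ r)
    exact (h1 U).trans (h1 V).symm
  | add x y hx hy =>
    exact ((algAd φ U).map_add' x y).trans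
      ((congrArg₂ (· + ·) hx hy).trans ((algAd φ V).map_add' x y).symm)
  | mul x y hx hy =>
    exact ((algAd φ U).map_mul' x y).trans
      ((congrArg₂ (· * ·) hx hy).trans ((algAd φ V).map_mul' x y).symm)
  | star x hx =>
    exact ((algAd φ U).map_star' x).trans
      ((congrArg star hx).trans ((algAd φ V).map_star' x).symm)

/-- The product action `⊙_i α_i` of `G` on the `*`-algebra `⊙_i B(H i)`, where `α_i = Ad (U i)`.
It is characterized by `algAction_tensorOp` below. -/
def algAction (φ : ∀ i, Metric.sphere (0 : H i) 1) {u : ℕ → TwoCocycle G}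
    (U : ∀ i, ProjUnitaryRep (u i) (H i)) : G →* (algTensor φ ≃⋆ₐ[ℂ] algTensor φ) :=
  MonoidHom.mk' (fun g => algAd φ fun i => (U i).toFun g) fun x y => by
    refine (algAd_congr φ (V := fun i => (U i).toFun x * (U i).toFun y) fun i => ?_).trans ?_
    · rw [map_mul]
      exact map_mul (U i).ad x y
    · exact StarAlgEquiv.ext fun z => algAdFun_mul _ _ z

theorem algAction_tensorOp (φ : ∀ i, Metric.sphere (0 : H i) 1) {u : ℕ → TwoCocycle G}
    (U : ∀ i, ProjUnitaryRep (u i) (H i)) (g : G) (J : Finset ℕ) (T : ∀ i, H i →L[ℂ] H i) :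
    algAction φ U g ⟨tensorOp φ J T, tensorOp_mem J T⟩
      = ⟨tensorOp φ J fun i => (U i).ad g (T i), tensorOp_mem J _⟩ :=
  algAd_tensorOp _ J T

/-- An action `β` of `G` on the `*`-algebra `⊙_i B(H i)` extends to an action of `G` on the von
Neumann algebra `⊗_i (B(H i), φ i)`, i.e. to a homomorphism from `G` to its group of
`*`-automorphisms. -/
def ExtendsToVN {φ : ∀ i, Metric.sphere (0 : H i) 1}
    (β : G →* (algTensor φ ≃⋆ₐ[ℂ] algTensor φ)) : Prop :=
  ∃ α : G →* ((vnTensor φ).toStarSubalgebra ≃⋆ₐ[ℂ] (vnTensor φ).toStarSubalgebra),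
    ∀ (g : G) (x : algTensor φ),
      (α g ⟨x, algTensor_le_vnTensor x.2⟩ : TensorSpace φ →L[ℂ] TensorSpace φ) = β g x

end Actions

section Regular

/-- The Hilbert space `ℓ²(G)`. -/
abbrev EllTwo (G : Type*) : Type _ := lp (fun _ : G => ℂ) 2

variable {G : Type*}

theorem memlp_weighted (e : G ≃ G) (c : G → Circle) (f : EllTwo G) :
    Memℓp (fun y => (c y : ℂ) * f (e y)) 2 := by
  refine memℓp_gen ?_
  have h := (lp.memℓp f).summable (by norm_num)
  simpa [Function.comp_def, Circle.norm_coe] using e.summable_iff.2 h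

/-- The unitary `f ↦ (y ↦ c y * f (e y))` of `ℓ²(G)`, for a permutation `e` of `G`. -/
def weightedPerm (e : G ≃ G) (c : G → Circle) : EllTwo G ≃ₗᵢ[ℂ] EllTwo G where
  toFun f := ⟨fun y => (c y : ℂ) * f (e y), memlp_weighted e c f⟩
  invFun f := ⟨fun y => ((c (e.symm y))⁻¹ : Circle) * f (e.symm y),
    memlp_weighted e.symm (fun y => (c (e.symm y))⁻¹) f⟩
  left_inv f := by
    ext y
    simp [← mul_assoc, ← Circle.coe_mul, -Circle.coe_inv]
  right_inv f := by
    ext y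
    simp [← mul_assoc, ← Circle.coe_mul, -Circle.coe_inv]
  map_add' f g := by
    ext y
    exact mul_add _ _ _
  map_smul' r f := by
    ext y
    simp [mul_left_comm]
  norm_map' f := by
    rw [lp.norm_eq_tsum_rpow (by norm_num), lp.norm_eq_tsum_rpow (by norm_num)]
    congr 1
    have h := e.tsum_eq fun y => ‖f y‖ ^ (2 : ENNReal).toReal
    simpa [Circle.norm_coe] using h

variable [Group G]

/-- The left `u`-regular projective unitary representation `λ_u` of `G` on `ℓ²(G)`. -/
def regularRep (u : TwoCocycle G) : ProjUnitaryRep u (EllTwo G) where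
  toFun x := Unitary.linearIsometryEquiv.symm
    (weightedPerm (Equiv.mulLeft x⁻¹) fun y => u.toFun y⁻¹ x)
  mul_eq x y := by
    refine ContinuousLinearMap.ext fun f => ?_
    ext z
    have h := u.cocycle z⁻¹ x y
    have h' := congrArg (fun a : Circle => (a : ℂ)) h
    simp only [Circle.coe_mul] at h'
    simp [weightedPerm, mul_assoc]
    rw [← mul_assoc, h', mul_assoc]

theorem regularRep_apply (u : TwoCocycle G) (x : G) (f : EllTwo G) (y : G) :
    ((regularRep u).toFun x : EllTwo G →L[ℂ] EllTwo G) f y = u.toFun y⁻¹ x * f (x⁻¹ * y) := rfl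

/-- Amenability of the discrete group `G`: there is a left-invariant mean on `ℓ^∞(G)`, i.e. a
positive unital linear functional that is invariant under left translations. -/
def IsAmenable (G : Type*) [Group G] : Prop :=
  ∃ m : lp (fun _ : G => ℝ) ⊤ →ₗ[ℝ] ℝ,
    m 1 = 1 ∧ (∀ f, (∀ y, 0 ≤ f y) → 0 ≤ m f) ∧
    ∀ (x : G) (f f' : lp (fun _ : G => ℝ) ⊤), (∀ y, f' y = f (x⁻¹ * y)) → m f' = m f

end Regular

end InfTensor

end

noncomputable section

namespace InfTensor

/-! ### Site projections and the projection onto their common fixed vectors -/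

section Space

variable {H : ℕ → Type v} [∀ i, NormedAddCommGroup (H i)] [∀ i, InnerProductSpace ℂ (H i)]
  {φ : ∀ i, Metric.sphere (0 : H i) 1}

/-! Suppose an automorphism `⊙_i Ad (U i)` extends to a `*`-automorphism `θ` of the von Neumann
algebra. Let `P_i` be the projection onto the line of `φ i` at site `i`, and let `p` be the
projection onto the vectors fixed by every `P_i`. Then `p` lies in the von Neumann algebra, is
nonzero because it fixes `⊗ φ i`, and satisfies `P_i p = p`. Applying `θ` gives `Q_i θ(p) = θ(p)`,
where `Q_i` projects onto the line of `U i (φ i)` at site `i`; no continuity of `θ` is needed, since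
these are purely algebraic relations. So some nonzero `ξ` is fixed by all `Q_i`. But `P_i → 1`
strongly (`tendsto_siteProj`), so `Q_i P_i ξ` approaches `ξ`, while `‖Q_i P_i‖ ≤ |⟨U i (φ i), φ
i⟩|`. Hence these coefficients tend to `1` in modulus (`tendsto_norm_inner_of_extends`).

For the regular representations the cocycles disappear on taking absolute values: `|⟨λ(x) φ i, φ i⟩|
≤ ∑ |φ i (x y)| |φ i y| ≤ 1`. Thus the vectors `|φ i|` are almost invariant under translation by
every `x`. This is impossible for uncountable `G`, because the `φ i` have countable supports
(`countable_of_tendsto`). It also makes `G` amenable, since an ultrafilter limit of the states given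
by the densities `|φ i|²` is an invariant mean (`isAmenable_of_tendsto`). -/

theorem norm_tensorOp_apply_le (J : Finset ℕ) (T : ∀ i, H i →L[ℂ] H i) (x : TensorSpace φ) :
    ‖tensorOp φ J T x‖ ≤ (∏ i ∈ J, ‖T i‖) * ‖x‖ := by
  induction x using UniformSpace.Completion.induction_on with
  | hp =>
    exact isClosed_le (tensorOp φ J T).continuous.norm (continuous_const.mul continuous_norm)
  | ih f =>
    rw [tensorOp, ContinuousLinearMap.completion_apply_coe, UniformSpace.Completion.norm_coe,
      UniformSpace.Completion.norm_coe]
    exact norm_applyOn_le J T f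

variable (φ) in
/-- The operator that projects onto the line of `φ i` at site `i`, and is trivial elsewhere. -/
def siteProj (i : ℕ) : TensorSpace φ →L[ℂ] TensorSpace φ :=
  tensorOp φ {i} fun j => InnerProductSpace.rankOne ℂ (φ j : H j) (φ j : H j)

theorem siteProj_tensor {i : ℕ} {ψ : Elem φ} (h : ψ.1 i = φ i) :
    siteProj φ i (tensor ψ) = tensor ψ := by
  rw [siteProj, tensorOp_tensor]
  congr 1
  refine Subtype.ext (funext fun j => ?_)
  by_cases hj : j = i
  · subst hj
    simp [applyOn, h, InnerProductSpace.rankOne_apply]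
  · simp [applyOn, hj]

theorem norm_siteProj_apply_le (i : ℕ) (x : TensorSpace φ) : ‖siteProj φ i x‖ ≤ ‖x‖ := by
  refine (norm_tensorOp_apply_le _ _ x).trans_eq ?_
  simp

-- An elementary tensor is fixed by all but finitely many of the projections, since it agrees with
-- `φ` outside a finite set. Density and the uniform bound `‖siteProj φ i‖ ≤ 1` carry this to every
-- vector.
open Filter Topology in
theorem tendsto_siteProj (x : TensorSpace φ) :
    Tendsto (fun i => siteProj φ i x) atTop (𝓝 x) := by
  have hspan : ∀ y ∈ Submodule.span ℂ (Set.range (tensor (φ := φ))),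
      ∀ᶠ i in atTop, siteProj φ i y = y := by
    intro y hy
    induction hy using Submodule.span_induction with
    | mem y hy =>
      obtain ⟨ψ, rfl⟩ := hy
      have h := ψ.2.compl_mem_cofinite
      rw [Nat.cofinite_eq_atTop] at h
      filter_upwards [h] with i hi
      exact siteProj_tensor (by simpa using hi)
    | zero => simp
    | add y z _ _ hy hz =>
      filter_upwards [hy, hz] with i h1 h2
      rw [map_add, h1, h2]
    | smul r y _ hy =>
      filter_upwards [hy] with i h1
      rw [map_smul, h1]
  rw [Metric.tendsto_nhds]
  intro ε hε
  have hx : x ∈ closure (Submodule.span ℂ (Set.range (tensor (φ := φ))) :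
      Set (TensorSpace φ)) := by
    rw [← Submodule.topologicalClosure_coe, dense_span_tensor]
    trivial
  obtain ⟨y, hy, hxy⟩ := Metric.mem_closure_iff.1 hx (ε / 2) (half_pos hε)
  filter_upwards [hspan y hy] with i hi
  have h1 := norm_siteProj_apply_le i (x - y)
  have h2 : siteProj φ i x - x = siteProj φ i (x - y) - (x - y) := by
    rw [map_sub, hi]
    abel
  rw [dist_eq_norm] at hxy ⊢
  rw [h2]
  have h3 := norm_sub_le (siteProj φ i (x - y)) (x - y)
  linarith

variable (φ) in
/-- The vectors that are fixed by all the projections `siteProj φ i`. -/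
def fixedSpace : Submodule ℂ (TensorSpace φ) :=
  ⨅ i, LinearMap.ker (siteProj φ i - 1 : TensorSpace φ →L[ℂ] TensorSpace φ).toLinearMap

theorem mem_fixedSpace {x : TensorSpace φ} : x ∈ fixedSpace φ ↔ ∀ i, siteProj φ i x = x := by
  simp [fixedSpace, sub_eq_zero]

instance : (fixedSpace φ).HasOrthogonalProjection := by
  have h : IsClosed (fixedSpace φ : Set (TensorSpace φ)) := by
    rw [fixedSpace, Submodule.coe_iInf]
    exact isClosed_iInter fun i =>
      ContinuousLinearMap.isClosed_ker (siteProj φ i - 1 : TensorSpace φ →L[ℂ] TensorSpace φ)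
  have : CompleteSpace (fixedSpace φ) := h.completeSpace_coe
  infer_instance

/-- The unit vector `⊗ φ i` is fixed by every site projection. -/
theorem starProjection_fixedSpace_ne_zero : (fixedSpace φ).starProjection ≠ 0 := by
  intro h
  let Ω : Elem φ := ⟨fun i => φ i, by simp⟩
  have h1 : tensor Ω ∈ fixedSpace φ := mem_fixedSpace.2 fun i => siteProj_tensor rfl
  have h2 := Submodule.starProjection_eq_self_iff.2 h1
  rw [h] at h2
  have h3 := inner_tensor Ω Ω
  rw [← h2] at h3
  simp [Ω] at h3

theorem commute_starProjection {E : Type*} [NormedAddCommGroup E] [InnerProductSpace ℂ E]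
    [CompleteSpace E] (L : Submodule ℂ E) [L.HasOrthogonalProjection] (X : E →L[ℂ] E)
    (h : ∀ v ∈ L, X v ∈ L) (h' : ∀ v ∈ L, star X v ∈ L) :
    X * L.starProjection = L.starProjection * X := by
  have key : ∀ Y : E →L[ℂ] E, (∀ v ∈ L, Y v ∈ L) →
      L.starProjection * (Y * L.starProjection) = Y * L.starProjection := fun Y hY =>
    ContinuousLinearMap.ext fun v =>
      Submodule.starProjection_eq_self_iff.2 (hY _ (Submodule.starProjection_apply_mem L v))
  have hs : star L.starProjection = L.starProjection := isSelfAdjoint_starProjection L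
  -- With `p` the projection onto `L`, invariance under `star X` reads `p (star X) p = (star X) p`;
  -- its adjoint is `p X p = p X`, to be compared with `p X p = X p`.
  have h2 := congrArg star (key (star X) h')
  simp only [star_mul, star_star, hs] at h2
  rw [← key X h, ← h2, mul_assoc]

end Space

/-! ### Consequences of an extension to the von Neumann algebra -/

section Algebra

variable {H : ℕ → Type v} [∀ i, NormedAddCommGroup (H i)] [∀ i, InnerProductSpace ℂ (H i)]
  {φ : ∀ i, Metric.sphere (0 : H i) 1}

/-- By the double commutant description, it suffices to commute with the commutant of the
generators. Elements of that commutant commute with each `siteProj φ i`, hence preserve the fixed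
space, and so do their adjoints. -/
theorem starProjection_fixedSpace_mem : (fixedSpace φ).starProjection ∈ vnTensor φ := by
  have key : ∀ X ∈ StarSubalgebra.centralizer ℂ {X | ∃ J T, X = tensorOp φ J T},
      ∀ v ∈ fixedSpace φ, X v ∈ fixedSpace φ := by
    intro X hX v hv
    refine mem_fixedSpace.2 fun i => ?_
    have h := (StarSubalgebra.mem_centralizer_iff ℂ).1 hX (siteProj φ i) ⟨_, _, rfl⟩
    have h1 := congrArg (fun Y : TensorSpace φ →L[ℂ] TensorSpace φ => Y v) h.1
    simp only [ContinuousLinearMap.mul_def, ContinuousLinearMap.comp_apply] at h1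
    rw [h1, mem_fixedSpace.1 hv i]
  change _ ∈ StarSubalgebra.centralizer ℂ _
  refine (StarSubalgebra.mem_centralizer_iff ℂ).2 fun X hX => ⟨?_, ?_⟩
  · exact commute_starProjection _ X (key X hX) (key _ (star_mem hX))
  · exact commute_starProjection _ _ (key _ (star_mem hX)) (by
      rw [star_star]
      exact key X hX)

theorem siteProj_mul_starProjection (i : ℕ) :
    siteProj φ i * (fixedSpace φ).starProjection = (fixedSpace φ).starProjection :=
  ContinuousLinearMap.ext fun v =>
    mem_fixedSpace.1 (Submodule.starProjection_apply_mem (fixedSpace φ) v) i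

variable [∀ i, CompleteSpace (H i)]

theorem algAd_siteProj (U : ∀ i, unitary (H i →L[ℂ] H i)) (i : ℕ) :
    (algAd φ U ⟨siteProj φ i, tensorOp_mem _ _⟩ : TensorSpace φ →L[ℂ] TensorSpace φ)
      = tensorOp φ {i} fun j => InnerProductSpace.rankOne ℂ
        ((U j : H j →L[ℂ] H j) (φ j)) ((U j : H j →L[ℂ] H j) (φ j)) := by
  have h := congrArg Subtype.val (algAd_tensorOp (φ := φ) U {i}
    fun j => InnerProductSpace.rankOne ℂ (φ j : H j) (φ j : H j))
  refine h.trans (congrArg (tensorOp φ {i}) (funext fun j => ?_))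
  refine ContinuousLinearMap.ext fun x => ?_
  simp [Unitary.conjStarAlgAut_apply, InnerProductSpace.rankOne_apply,
    ContinuousLinearMap.star_eq_adjoint, ContinuousLinearMap.adjoint_inner_right]

open Filter Topology in
/-- If the product automorphism `⊙_i Ad (U i)` extends to an injective multiplicative map on the
von Neumann algebra, then `φ i` is asymptotically an eigenvector of `U i`. -/
theorem tendsto_norm_inner_of_extends (U : ∀ i, unitary (H i →L[ℂ] H i))
    (θ : (vnTensor φ).toStarSubalgebra ≃⋆ₐ[ℂ] (vnTensor φ).toStarSubalgebra)
    (hθ : ∀ x : algTensor φ,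
      (θ ⟨x, algTensor_le_vnTensor x.2⟩ : TensorSpace φ →L[ℂ] TensorSpace φ) = algAd φ U x) :
    Tendsto (fun i => ‖inner ℂ ((U i : H i →L[ℂ] H i) (φ i)) (φ i : H i)‖) atTop (𝓝 1) := by
  let p : (vnTensor φ).toStarSubalgebra := ⟨_, starProjection_fixedSpace_mem⟩
  have hp : (θ p : TensorSpace φ →L[ℂ] TensorSpace φ) ≠ 0 := by
    intro h
    have h1 : θ p = 0 := Subtype.ext h
    rw [EmbeddingLike.map_eq_zero_iff] at h1
    exact starProjection_fixedSpace_ne_zero (congrArg Subtype.val h1)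
  obtain ⟨v, hv⟩ : ∃ v, (θ p : TensorSpace φ →L[ℂ] TensorSpace φ) v ≠ 0 := by
    by_contra! h
    exact hp (ContinuousLinearMap.ext h)
  set ξ := (θ p : TensorSpace φ →L[ℂ] TensorSpace φ) v with hξ
  let q : ℕ → TensorSpace φ →L[ℂ] TensorSpace φ := fun i =>
    tensorOp φ {i} fun j => InnerProductSpace.rankOne ℂ
        ((U j : H j →L[ℂ] H j) (φ j)) ((U j : H j →L[ℂ] H j) (φ j))
  have hq : ∀ i, q i ξ = ξ := by
    -- The relation `P_i p = p` is transported by `θ`, which is known explicitly on `P_i`.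
    intro i
    let P : algTensor φ := ⟨siteProj φ i, tensorOp_mem _ _⟩
    have h1 : θ ⟨P, algTensor_le_vnTensor P.2⟩ * θ p = θ p := by
      rw [← map_mul]
      congr 1
      exact Subtype.ext (siteProj_mul_starProjection i)
    have h2 := congrArg Subtype.val h1
    have h3 : (θ ⟨P, algTensor_le_vnTensor P.2⟩ : TensorSpace φ →L[ℂ] TensorSpace φ) = q i :=
      (hθ P).trans (algAd_siteProj U i)
    have h4 : q i * (θ p : TensorSpace φ →L[ℂ] TensorSpace φ) = θ p := by
      rw [← h3]
      exact h2
    exact congrArg (fun Y : TensorSpace φ →L[ℂ] TensorSpace φ => Y v) h4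
  set c : ℕ → ℂ := fun i => inner ℂ ((U i : H i →L[ℂ] H i) (φ i)) (φ i : H i)
  have hU : ∀ i, ‖(U i : H i →L[ℂ] H i) (φ i)‖ = 1 := fun i =>
    ((Unitary.linearIsometryEquiv (U i)).norm_map (φ i : H i)).trans (by simp)
  have hc : ∀ i, ‖c i‖ ≤ 1 := fun i =>
    (norm_inner_le_norm _ _).trans_eq (by rw [hU]; simp)
  have hq_norm : ∀ i x, ‖q i x‖ ≤ ‖x‖ := fun i x =>
    (norm_tensorOp_apply_le _ _ x).trans_eq (by simp [hU])
  have hqp : ∀ i x, ‖q i (siteProj φ i x)‖ ≤ ‖c i‖ * ‖x‖ := by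
    intro i x
    -- At site `i` the product of the two rank-one projections is, up to conjugating the scalar, `c
    -- i` times a rank-one operator between unit vectors.
    have h1 : q i (siteProj φ i x) = (q i * siteProj φ i) x := rfl
    rw [h1, siteProj, tensorOp_mul]
    refine (norm_tensorOp_apply_le _ _ x).trans ?_
    rw [Finset.prod_singleton]
    gcongr
    refine ContinuousLinearMap.opNorm_le_bound _ (norm_nonneg _) fun y => ?_
    have h2 : ‖inner ℂ (φ i : H i) y‖ ≤ ‖y‖ := (norm_inner_le_norm _ _).trans_eq (by simp)
    simp only [ContinuousLinearMap.mul_def, ContinuousLinearMap.comp_apply,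
      InnerProductSpace.rankOne_apply, map_smul, norm_smul, hU, mul_one]
    rw [mul_comm]
    exact mul_le_mul_of_nonneg_left h2 (norm_nonneg _)
  have hlow : ∀ i, 1 - ‖siteProj φ i ξ - ξ‖ / ‖ξ‖ ≤ ‖c i‖ := by
    intro i
    have h0 : 0 < ‖ξ‖ := norm_pos_iff.2 hv
    -- Since `ξ` is fixed by `q i`, replacing `ξ` by `siteProj φ i ξ` costs only the error `siteProj
    -- φ i ξ - ξ`, which `q i` does not enlarge.
    have h1 : ξ = q i (siteProj φ i ξ) - q i (siteProj φ i ξ - ξ) := by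
      rw [map_sub, hq]
      abel
    have h2 : ‖ξ‖ ≤ ‖q i (siteProj φ i ξ)‖ + ‖q i (siteProj φ i ξ - ξ)‖ := by
      conv_lhs => rw [h1]
      exact norm_sub_le _ _
    have h3 := hqp i ξ
    have h4 := hq_norm i (siteProj φ i ξ - ξ)
    rw [sub_le_iff_le_add, ← sub_le_iff_le_add', le_div_iff₀ h0]
    linarith
  have hlim : Tendsto (fun i => 1 - ‖siteProj φ i ξ - ξ‖ / ‖ξ‖) atTop (𝓝 1) := by
    have h1 := (tendsto_iff_norm_sub_tendsto_zero.1 (tendsto_siteProj ξ)).div_const ‖ξ‖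
    simpa using h1.const_sub 1
  exact tendsto_of_tendsto_of_tendsto_of_le_of_le hlim tendsto_const_nhds hlow hc

end Algebra

/-! ### Almost invariant vectors, invariant means and countability -/

section Mean

variable {G : Type*}

theorem summable_norm_sq (f : EllTwo G) : Summable fun y => ‖f y‖ ^ 2 := by
  simpa using (lp.memℓp f).summable (by norm_num)

theorem tsum_norm_sq (f : Metric.sphere (0 : EllTwo G) 1) :
    ∑' y, ‖(f : EllTwo G) y‖ ^ 2 = 1 := by
  have h := lp.norm_rpow_eq_tsum (p := 2) (by norm_num) (f : EllTwo G)
  simpa using h.symm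

theorem summable_mul_norm_sq (f : EllTwo G) (g : lp (fun _ : G => ℝ) ⊤) :
    Summable fun y => g y * ‖f y‖ ^ 2 := by
  refine Summable.of_norm_bounded ((summable_norm_sq f).mul_left ‖g‖) fun y => ?_
  rw [norm_mul, norm_pow, norm_norm]
  gcongr
  exact lp.norm_apply_le_norm (by simp) g y

/-- The state `g ↦ ∑ g y |f y|²` of `ℓ^∞(G)` for a vector `f` of `ℓ²(G)`. -/
def vectorMean (f : EllTwo G) : lp (fun _ : G => ℝ) ⊤ →ₗ[ℝ] ℝ where
  toFun g := ∑' y, g y * ‖f y‖ ^ 2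
  map_add' g h := by
    rw [← (summable_mul_norm_sq f g).tsum_add (summable_mul_norm_sq f h)]
    exact tsum_congr fun y => add_mul _ _ _
  map_smul' r g := by
    rw [RingHom.id_apply, smul_eq_mul, ← tsum_mul_left]
    exact tsum_congr fun y => mul_assoc _ _ _

theorem vectorMean_apply (f : EllTwo G) (g : lp (fun _ : G => ℝ) ⊤) :
    vectorMean f g = ∑' y, g y * ‖f y‖ ^ 2 := rfl

theorem abs_vectorMean_le (f : Metric.sphere (0 : EllTwo G) 1) (g : lp (fun _ : G => ℝ) ⊤) :
    |vectorMean (f : EllTwo G) g| ≤ ‖g‖ := by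
  have h := ((summable_norm_sq (f : EllTwo G)).mul_left ‖g‖).hasSum
  rw [tsum_mul_left, tsum_norm_sq, mul_one] at h
  rw [← Real.norm_eq_abs, vectorMean_apply]
  refine tsum_of_norm_bounded h fun y => ?_
  rw [norm_mul, norm_pow, norm_norm]
  gcongr
  exact lp.norm_apply_le_norm (by simp) g y

-- The values stay in the compact interval `[-‖g‖, ‖g‖]`, where every ultrafilter converges.
open Filter Topology in
theorem exists_tendsto_vectorMean (φ : ℕ → Metric.sphere (0 : EllTwo G) 1)
    (g : lp (fun _ : G => ℝ) ⊤) :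
    ∃ a, Tendsto (fun i => vectorMean (φ i : EllTwo G) g) (hyperfilter ℕ : Filter ℕ) (𝓝 a) := by
  obtain ⟨a, -, ha⟩ := (isCompact_Icc (a := -‖g‖) (b := ‖g‖)).ultrafilter_le_nhds
    ((hyperfilter ℕ).map fun i => vectorMean (φ i : EllTwo G) g) (by
      refine le_principal_iff.2 (Filter.mem_map.2 (Filter.univ_mem' fun i => ?_))
      exact abs_le.1 (abs_vectorMean_le (φ i) g))
  exact ⟨a, ha⟩

open Filter Topology in
/-- A limit of the states `vectorMean (φ i)` along a free ultrafilter. -/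
def limitMean (φ : ℕ → Metric.sphere (0 : EllTwo G) 1) : lp (fun _ : G => ℝ) ⊤ →ₗ[ℝ] ℝ where
  toFun g := (exists_tendsto_vectorMean φ g).choose
  map_add' g h := by
    -- The limits are chosen separately for each function; uniqueness of limits makes the choice
    -- additive.
    refine tendsto_nhds_unique (exists_tendsto_vectorMean φ (g + h)).choose_spec ?_
    simp only [map_add]
    exact (exists_tendsto_vectorMean φ g).choose_spec.add
      (exists_tendsto_vectorMean φ h).choose_spec
  map_smul' r g := by
    refine tendsto_nhds_unique (exists_tendsto_vectorMean φ (r • g)).choose_spec ?_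
    simp only [map_smul]
    exact (exists_tendsto_vectorMean φ g).choose_spec.const_smul r

open Filter Topology in
theorem tendsto_limitMean (φ : ℕ → Metric.sphere (0 : EllTwo G) 1)
    (g : lp (fun _ : G => ℝ) ⊤) :
    Tendsto (fun i => vectorMean (φ i : EllTwo G) g) (hyperfilter ℕ : Filter ℕ)
      (𝓝 (limitMean φ g)) :=
  (exists_tendsto_vectorMean φ g).choose_spec

variable [Group G]

theorem summable_norm_mul_translate (f : EllTwo G) (x : G) :
    Summable fun y => ‖f (x * y)‖ * ‖f y‖ := by
  have h := ((Equiv.mulLeft x).summable_iff.2 (summable_norm_sq f)).add (summable_norm_sq f)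
  refine Summable.of_nonneg_of_le (fun y => by positivity) (fun y => ?_) h
  simp only [Function.comp_apply, Equiv.coe_mulLeft]
  nlinarith [two_mul_le_add_sq ‖f (x * y)‖ ‖f y‖, sq_nonneg ‖f (x * y)‖, sq_nonneg ‖f y‖]

theorem summable_norm_sq_translate (f : EllTwo G) (x : G) :
    Summable fun y => ‖f (x * y)‖ ^ 2 :=
  (Equiv.mulLeft x).summable_iff.2 (summable_norm_sq f)

theorem tsum_norm_sq_translate (f : Metric.sphere (0 : EllTwo G) 1) (x : G) :
    ∑' y, ‖(f : EllTwo G) (x * y)‖ ^ 2 = 1 :=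
  ((Equiv.mulLeft x).tsum_eq fun y => ‖(f : EllTwo G) y‖ ^ 2).trans (tsum_norm_sq f)

theorem tsum_norm_mul_translate_le_one (f : Metric.sphere (0 : EllTwo G) 1) (x : G) :
    ∑' y, ‖(f : EllTwo G) (x * y)‖ * ‖(f : EllTwo G) y‖ ≤ 1 := by
  have hF := summable_norm_sq (f : EllTwo G)
  have hxF := summable_norm_sq_translate (f : EllTwo G) x
  refine ((summable_norm_mul_translate (f : EllTwo G) x).tsum_le_tsum (fun y => ?_)
    ((hxF.add hF).div_const 2)).trans_eq ?_
  · have := two_mul_le_add_sq ‖(f : EllTwo G) (x * y)‖ ‖(f : EllTwo G) y‖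
    linarith
  · rw [tsum_div_const, hxF.tsum_add hF, tsum_norm_sq_translate, tsum_norm_sq]
    norm_num

/-- The triangle inequality removes the cocycle, whose values have modulus one; the substitution `y
↦ x * y` then turns `x⁻¹ * y` into `y`. -/
theorem norm_inner_regularRep_le (u : TwoCocycle G) (x : G) (f : EllTwo G) :
    ‖inner ℂ (((regularRep u).toFun x : EllTwo G →L[ℂ] EllTwo G) f) f‖
      ≤ ∑' y, ‖f (x * y)‖ * ‖f y‖ := by
  rw [lp.inner_eq_tsum]
  have h : ∀ y, ‖inner ℂ (((regularRep u).toFun x : EllTwo G →L[ℂ] EllTwo G) f y) (f y)‖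
      = ‖f y‖ * ‖f (x⁻¹ * y)‖ := by
    intro y
    rw [regularRep_apply]
    simp [Circle.norm_coe]
  have e : (fun y => ‖f (x * y)‖ * ‖f y‖)
      = (fun y => ‖f y‖ * ‖f (x⁻¹ * y)‖) ∘ Equiv.mulLeft x := by
    funext y
    simp
  have hs := summable_norm_mul_translate f x
  rw [e, (Equiv.mulLeft x).summable_iff] at hs
  refine (tsum_of_norm_bounded hs.hasSum fun y => (h y).le).trans_eq ?_
  exact (((Equiv.mulLeft x).tsum_eq fun y => ‖f y‖ * ‖f (x⁻¹ * y)‖).symm.trans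
    (congrArg tsum e.symm))

/-- With `a = |f (x y)|` and `b = |f y|`, the weighted inequality `|a² - b²| ≤ ((a - b)² / t + t (a
+ b)²) / 2` is summed over `y`. It plays the role of Cauchy–Schwarz, and the free parameter `t`
avoids square roots. -/
theorem abs_vectorMean_sub_le (f : Metric.sphere (0 : EllTwo G) 1) (x : G)
    (g g' : lp (fun _ : G => ℝ) ⊤) (h : ∀ y, g' y = g (x⁻¹ * y)) {t : ℝ} (ht : 0 < t) :
    |vectorMean (f : EllTwo G) g' - vectorMean (f : EllTwo G) g|
      ≤ ‖g‖ * ((1 - ∑' y, ‖(f : EllTwo G) (x * y)‖ * ‖(f : EllTwo G) y‖) / t + 2 * t) := by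
  set F : EllTwo G := (f : EllTwo G)
  have hF : Summable fun y => ‖F y‖ ^ 2 := summable_norm_sq F
  have hF1 : ∑' y, ‖F y‖ ^ 2 = 1 := tsum_norm_sq f
  have hxF : Summable fun y => ‖F (x * y)‖ ^ 2 := summable_norm_sq_translate F x
  have hxF1 : ∑' y, ‖F (x * y)‖ ^ 2 = 1 := tsum_norm_sq_translate f x
  have hc := summable_norm_mul_translate F x
  set c := ∑' y, ‖F (x * y)‖ * ‖F y‖
  have e : (fun y => g y * ‖F (x * y)‖ ^ 2) = (fun y => g' y * ‖F y‖ ^ 2) ∘ Equiv.mulLeft x := by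
    funext y
    simp [h]
  have h1 : HasSum (fun y => g y * ‖F (x * y)‖ ^ 2) (vectorMean F g') := by
    rw [e, (Equiv.mulLeft x).hasSum_iff]
    exact (summable_mul_norm_sq F g').hasSum
  have h2 := h1.sub (summable_mul_norm_sq F g).hasSum
  -- The coefficients come from expanding `((a - b)² / t + t (a + b)²) / 2` in `a² + b²` and `a b`.
  have hb : HasSum (fun y => ‖g‖ * ((‖F (x * y)‖ ^ 2 + ‖F y‖ ^ 2) * (1 / (2 * t) + t / 2)
      + ‖F (x * y)‖ * ‖F y‖ * (t - 1 / t)))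
      (‖g‖ * ((1 + 1) * (1 / (2 * t) + t / 2) + c * (t - 1 / t))) := by
    refine HasSum.mul_left _ (HasSum.add (HasSum.mul_right _ (HasSum.add ?_ ?_))
      (HasSum.mul_right _ hc.hasSum))
    · exact hxF1 ▸ hxF.hasSum
    · exact hF1 ▸ hF.hasSum
  have hc1 : c ≤ 1 := tsum_norm_mul_translate_le_one f x
  have h4 : |vectorMean F g' - vectorMean F g|
      ≤ ‖g‖ * ((1 + 1) * (1 / (2 * t) + t / 2) + c * (t - 1 / t)) := by
    rw [vectorMean_apply F g, ← h2.tsum_eq, ← Real.norm_eq_abs]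
    refine tsum_of_norm_bounded hb fun y => ?_
    rw [← mul_sub, norm_mul]
    refine mul_le_mul (lp.norm_apply_le_norm (by simp) g y) ?_ (norm_nonneg _) (norm_nonneg _)
    generalize ‖F (x * y)‖ = a
    generalize ‖F y‖ = b
    have e1 : (a ^ 2 + b ^ 2) * (1 / (2 * t) + t / 2) + a * b * (t - 1 / t)
        = ((a - b) ^ 2 / t + t * (a + b) ^ 2) / 2 := by
      field_simp
      ring
    have e2 : ((a - b) ^ 2 / t + t * (a + b) ^ 2) / 2 - (a ^ 2 - b ^ 2)
        = ((a - b) - t * (a + b)) ^ 2 / (2 * t) := by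
      field_simp
      ring
    have e3 : ((a - b) ^ 2 / t + t * (a + b) ^ 2) / 2 + (a ^ 2 - b ^ 2)
        = ((a - b) + t * (a + b)) ^ 2 / (2 * t) := by
      field_simp
      ring
    have p2 : 0 ≤ ((a - b) - t * (a + b)) ^ 2 / (2 * t) := by positivity
    have p3 : 0 ≤ ((a - b) + t * (a + b)) ^ 2 / (2 * t) := by positivity
    rw [e1, Real.norm_eq_abs, abs_le]
    constructor <;> linarith
  refine h4.trans (mul_le_mul_of_nonneg_left ?_ (norm_nonneg _))
  have e4 : (1 + 1) * (1 / (2 * t) + t / 2) + c * (t - 1 / t) = (1 - c) / t + (1 + c) * t := by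
    field_simp
    ring
  rw [e4]
  nlinarith

-- The mean is `limitMean φ`. Its invariance follows from `abs_vectorMean_sub_le` by taking the
-- limit over `i` with `t` fixed, and only then letting `t` tend to `0`.
open Filter Topology in
theorem isAmenable_of_tendsto (φ : ℕ → Metric.sphere (0 : EllTwo G) 1)
    (h : ∀ x : G, Tendsto (fun i => ∑' y, ‖(φ i : EllTwo G) (x * y)‖ * ‖(φ i : EllTwo G) y‖)
      atTop (𝓝 1)) : IsAmenable G := by
  refine ⟨limitMean φ, ?_, fun g hg => ?_, fun x g g' hg => ?_⟩
  · refine tendsto_nhds_unique (tendsto_limitMean φ 1) ?_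
    simp only [vectorMean_apply, lp.infty_coeFn_one, Pi.one_apply, one_mul, tsum_norm_sq]
    exact tendsto_const_nhds
  · exact ge_of_tendsto' (tendsto_limitMean φ g) fun i =>
      tsum_nonneg fun y => mul_nonneg (hg y) (by positivity)
  · have hx := (h x).mono_left Nat.hyperfilter_le_atTop
    have hsub := ((tendsto_limitMean φ g').sub (tendsto_limitMean φ g)).abs
    have hb : ∀ t : ℝ, 0 < t → |limitMean φ g' - limitMean φ g| ≤ ‖g‖ * (2 * t) := by
      intro t ht
      have h1 := (((hx.const_sub 1).div_const t).add_const (2 * t)).const_mul ‖g‖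
      simp only [sub_self, zero_div, zero_add] at h1
      exact le_of_tendsto_of_tendsto' hsub h1 fun i => abs_vectorMean_sub_le (φ i) x g g' hg ht
    have ht : Tendsto (fun t : ℝ => ‖g‖ * (2 * t)) (𝓝[>] 0) (𝓝 0) := by
      have h2 : Tendsto (fun t : ℝ => ‖g‖ * (2 * t)) (𝓝 0) (𝓝 (‖g‖ * (2 * 0))) :=
        (continuous_const.mul (continuous_const.mul continuous_id)).tendsto 0
      simpa using h2.mono_left nhdsWithin_le_nhds
    have h3 := ge_of_tendsto ht (eventually_mem_nhdsWithin.mono fun t ht => hb t ht)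
    exact sub_eq_zero.1 (abs_nonpos_iff.1 h3)

-- Let `S` be the union of the supports of the `φ i`, a countable set. If `x` is not of the form `a
-- * b⁻¹` with `a, b ∈ S`, every overlap sum at `x` vanishes and cannot tend to `1`; so these
-- quotients exhaust `G`.
open Filter Topology in
theorem countable_of_tendsto (φ : ℕ → Metric.sphere (0 : EllTwo G) 1)
    (h : ∀ x : G, Tendsto (fun i => ∑' y, ‖(φ i : EllTwo G) (x * y)‖ * ‖(φ i : EllTwo G) y‖)
      atTop (𝓝 1)) : Countable G := by
  have hS : (⋃ i, {y | (φ i : EllTwo G) y ≠ 0}).Countable := by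
    refine Set.countable_iUnion fun i => ?_
    refine (summable_norm_sq (φ i : EllTwo G)).countable_support.mono fun y hy => ?_
    simpa using hy
  set S := ⋃ i, {y | (φ i : EllTwo G) y ≠ 0}
  have hdiv : (Set.image2 (fun a b : G => a * b⁻¹) S S).Countable := hS.image2 hS _
  refine Set.countable_univ_iff.1 (hdiv.mono fun x _ => ?_)
  by_contra hx
  have h0 : ∀ i, ∑' y, ‖(φ i : EllTwo G) (x * y)‖ * ‖(φ i : EllTwo G) y‖ = 0 := by
    intro i
    refine (tsum_congr fun y => ?_).trans tsum_zero
    by_contra hy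
    rw [mul_eq_zero, norm_eq_zero, norm_eq_zero, not_or] at hy
    exact hx ⟨x * y, Set.mem_iUnion.2 ⟨i, hy.1⟩, y, Set.mem_iUnion.2 ⟨i, hy.2⟩, by simp⟩
  have h1 := h x
  simp only [h0] at h1
  exact zero_ne_one (tendsto_nhds_unique tendsto_const_nhds h1)

end Mean

end InfTensor

end

/-! ### The main theorem -/

theorem theorem5p5 {G : Type*} [Group G] (hG : Uncountable G ∨ ¬ InfTensor.IsAmenable G)
    (u : ℕ → InfTensor.TwoCocycle G)
    (φ : ℕ → Metric.sphere (0 : InfTensor.EllTwo G) 1) :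
    ¬ InfTensor.ExtendsToVN (InfTensor.algAction φ fun i => InfTensor.regularRep (u i)) := by
  rintro ⟨α, hα⟩
  have h : ∀ x : G, Filter.Tendsto (fun i => ∑' y, ‖(φ i : InfTensor.EllTwo G) (x * y)‖ *
      ‖(φ i : InfTensor.EllTwo G) y‖) Filter.atTop (nhds 1) := fun x =>
    -- The overlap sums are squeezed between the moduli of the coefficients, which tend to `1`, and
    -- `1` itself.
    tendsto_of_tendsto_of_tendsto_of_le_of_le
      (InfTensor.tendsto_norm_inner_of_extends _ (α x) (hα x)) tendsto_const_nhds
      (fun i => InfTensor.norm_inner_regularRep_le (u i) x (φ i))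
      (fun i => InfTensor.tsum_norm_mul_translate_le_one (φ i) x)
  rcases hG with hG | hG
  · exact not_countable_iff.2 hG (InfTensor.countable_of_tendsto φ h)
  · exact hG (InfTensor.isAmenable_of_tendsto φ h)
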